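/- All C*-algebras are complex and need not be unital. Let $\mathfrak A$ be a C*-algebra. A compatible action of $\mathfrak A$ on a C*-algebra $A$ is a pair of bilinear maps $(\alpha,a)\mapsto\alpha\cdot a$, $(a,\alpha)\mapsto a\cdot\alpha$ into $A$ such that, for some $k>0$ and all $\alpha\in\mathfrak A$, $a,b\in A$: $\|\alpha\cdot a\|,\|a\cdot\alpha\|\le k\|a\|\|\alpha\|$; $\alpha\cdot(ab)=(\alpha\cdot a)b$ and $(ab)\cdot\alpha=a(b\cdot\alpha)$; $(\alpha\cdot a)^*=a^*\cdot\alpha^*$ and $(a\cdot\alpha)^*=\alpha^*\cdot a^*$. The action is left-trivial with character $f$ (a nonzero multiplicative linear functional on $\mathfrak A$) if $\alpha\cdot a=f(\alpha)a$ for all $\alpha,a$. A linear map $u$ is $\mathfrak A$-linear if $u(\alpha\cdot a)=\alpha\cdot u(a)$ and $u(a\cdot\alpha)=u(a)\cdot\alpha$. For C*-algebras $A,C$ with compatible actions of $\mathfrak A$, let $A\odot C$ be the algebraic tensor product, $I_{A,C}$ the two-sided ideal of $A\odot C$ generated by the elements $a\cdot\alpha\otimes c-a\otimes\alpha\cdot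 c$, and $A\odot_{\mathfrak A}C=(A\odot C)/I_{A,C}$. For $\gamma\in\{\min,\max\}$ let $\|\cdot\|_\gamma$ be the minimal (spatial), respectively maximal, C*-norm on $A\odot C$, and put $\|x+I_{A,C}\|_\gamma=\inf_{i\in I_{A,C}}\|x+i\|_\gamma$. An $\mathfrak A$-linear map $u:A\to B$ is called $\mathfrak A$-$(\gamma\to\eta)$-tensorizing if for every C*-algebra $C$ with a compatible action of $\mathfrak A$ the map $u\odot\mathrm{id}_C$ induces a linear map $u\odot_{\mathfrak A}\mathrm{id}_C:A\odot_{\mathfrak A}C\to B\odot_{\mathfrak A}C$ and $$\|(u\odot_{\mathfrak A}\mathrm{id}_C)(\bar x)\|_\eta\le\|\bar x\|_\gamma\qquad(\bar x\in A\odot_{\mathfrak A}C).$$ Theorem. Let $A$ and $B$ be C*-algebras with compatible actions of $\mathfrak A$ that are left-trivial with the same character $f$, and let $u:A\to B$ be an $\mathfrak A$-linear map. Then: (i) if $u$ is completely positive and $\|u\|\le1$, then $u$ is $\mathfrak A$-$(\max\to\max)$-tensorizing; (ii) if $\|u\|_{cb}\le1$, then $u$ is $\mathfrak A$-$(\min\to\min)$-tensorizing.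 -/

import Mathlib

open scoped TensorProduct ENNReal

universe u v w

/-- A compatible action of the C*-algebra `𝔄` on the C*-algebra `A`: bilinear, bounded left and
right actions `α · a` and `a · α` which are compatible with the product and involution of `A`. -/
structure CompatibleAction (𝔄 : Type*) (A : Type*)
    [NonUnitalCStarAlgebra 𝔄] [NonUnitalCStarAlgebra A] where
  /-- The left action `(α, a) ↦ α · a`. -/
  left : 𝔄 →ₗ[ℂ] A →ₗ[ℂ] A
  /-- The right action `(a, α) ↦ a · α`. -/
  right : A →ₗ[ℂ] 𝔄 →ₗ[ℂ] A
  bounded : ∃ k : ℝ, 0 < k ∧ ∀ (α : 𝔄) (a : A),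
    ‖right a α‖ ≤ k * ‖a‖ * ‖α‖ ∧ ‖left α a‖ ≤ k * ‖a‖ * ‖α‖
  left_mul : ∀ (α : 𝔄) (a b : A), left α (a * b) = left α a * b
  mul_right : ∀ (α : 𝔄) (a b : A), right (a * b) α = a * right b α
  star_left : ∀ (α : 𝔄) (a : A), star (left α a) = right (star a) (star α)
  star_right : ∀ (α : 𝔄) (a : A), star (right a α) = left (star α) (star a)

/-- The action is left-trivial with character `f`: `α · a = f(α) a`. -/
def CompatibleAction.IsLeftTrivial {𝔄 A : Type*}
    [NonUnitalCStarAlgebra 𝔄] [NonUnitalCStarAlgebra A] (act : CompatibleAction 𝔄 A)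
    (f : WeakDual.characterSpace ℂ 𝔄) : Prop :=
  ∀ (α : 𝔄) (a : A), act.left α a = f α • a

/-- `𝔄`-linearity of a linear map: `u(α · a) = α · u(a)` and `u(a · α) = u(a) · α`. -/
def IsModuleLinear {𝔄 A B : Type*} [NonUnitalCStarAlgebra 𝔄]
    [NonUnitalCStarAlgebra A] [NonUnitalCStarAlgebra B]
    (actA : CompatibleAction 𝔄 A) (actB : CompatibleAction 𝔄 B) (u : A →ₗ[ℂ] B) : Prop :=
  ∀ (α : 𝔄) (a : A),
    u (actA.left α a) = actB.left α (u a) ∧ u (actA.right a α) = actB.right (u a) α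

/-- The completely bounded norm `‖u‖_cb = sup_n ‖id ⊗ u : M_n(A) → M_n(B)‖` (possibly `∞`),
where `M_n(A)`, `M_n(B)` carry their C*-norms. -/
noncomputable def cbNorm {A B : Type*} [NonUnitalCStarAlgebra A] [PartialOrder A]
    [StarOrderedRing A] [NonUnitalCStarAlgebra B] [PartialOrder B] [StarOrderedRing B]
    (u : A →ₗ[ℂ] B) : ℝ≥0∞ :=
  ⨆ (n : ℕ) (M : CStarMatrix (Fin n) (Fin n) A) (_ : ‖M‖ ≤ 1), ‖M.map u‖ₑ

section TensorNorms

variable {A : Type u} {C : Type w} [NonUnitalCStarAlgebra A] [NonUnitalCStarAlgebra C]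

/-- For representations `π` of `A` on `H` and `σ` of `C` on `K`, the linear map
`∑ aᵢ ⊗ cᵢ ↦ ∑ π(aᵢ) ⊗ σ(cᵢ)` from `A ⊙ C` to the bounded operators on the algebraic tensor
product `H ⊗ K` with its inner product. Since `H ⊗ K` is dense in the Hilbert space tensor
product, the operator norm is the norm of the extension to the Hilbert space tensor product. -/
noncomputable def tensorRep
    {H : Type*} [NormedAddCommGroup H] [InnerProductSpace ℂ H] [CompleteSpace H]
    {K : Type*} [NormedAddCommGroup K] [InnerProductSpace ℂ K] [CompleteSpace K]
    (π : A →⋆ₙₐ[ℂ] (H →L[ℂ] H)) (σ : C →⋆ₙₐ[ℂ] (K →L[ℂ] K)) :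
    A ⊗[ℂ] C →ₗ[ℂ] ((H ⊗[ℂ] K) →L[ℂ] (H ⊗[ℂ] K)) :=
  TensorProduct.lift (LinearMap.mk₂ ℂ (fun a c => TensorProduct.mapL (π a) (σ c))
    (fun a a' c => by
      ext x; simp [TensorProduct.map_add_left])
    (fun r a c => by
      ext x; simp [TensorProduct.map_smul_left])
    (fun a c c' => by
      ext x; simp [TensorProduct.map_add_right])
    (fun r a c => by
      ext x; simp [TensorProduct.map_smul_right]))

/-- The minimal (spatial) norm on `A ⊙ C`: the norm of `∑ π(aᵢ) ⊗ σ(cᵢ)` for injective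
representations `π` of `A` and `σ` of `C` (the value is the same for all such pairs). -/
noncomputable def minTensorNorm (x : A ⊗[ℂ] C) : ℝ≥0∞ :=
  ⨆ (H : Type u) (_ : NormedAddCommGroup H) (_ : InnerProductSpace ℂ H) (_ : CompleteSpace H)
    (K : Type w) (_ : NormedAddCommGroup K) (_ : InnerProductSpace ℂ K) (_ : CompleteSpace K)
    (π : A →⋆ₙₐ[ℂ] (H →L[ℂ] H)) (_ : Function.Injective π)
    (σ : C →⋆ₙₐ[ℂ] (K →L[ℂ] K)) (_ : Function.Injective σ),
    ‖tensorRep π σ x‖ₑ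

/-- The maximal norm on `A ⊙ C`: the supremum of `‖ρ(x)‖` over all *-homomorphisms `ρ` of `A ⊙ C`
into the bounded operators on a Hilbert space. -/
noncomputable def maxTensorNorm (x : A ⊗[ℂ] C) : ℝ≥0∞ :=
  ⨆ (H : Type (max u w)) (_ : NormedAddCommGroup H) (_ : InnerProductSpace ℂ H)
    (_ : CompleteSpace H) (ρ : A ⊗[ℂ] C →⋆ₙₐ[ℂ] (H →L[ℂ] H)), ‖ρ x‖ₑ

end TensorNorms

/-- The two symbols `min` and `max`. -/
inductive TensorNormKind
  | min
  | max

/-- The C*-norm `‖·‖_γ` on `A ⊙ C`, for `γ = min` or `γ = max`. -/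
noncomputable def cstarTensorNorm (γ : TensorNormKind) {A : Type u} {C : Type w}
    [NonUnitalCStarAlgebra A] [NonUnitalCStarAlgebra C] (x : A ⊗[ℂ] C) : ℝ≥0∞ :=
  match γ with
  | .min => minTensorNorm x
  | .max => maxTensorNorm x

section ModuleTensor

variable {𝔄 : Type*} {A : Type u} {C : Type w}
  [NonUnitalCStarAlgebra 𝔄] [NonUnitalCStarAlgebra A] [NonUnitalCStarAlgebra C]

/-- The two-sided ideal `I_{A,C}` of the algebra `A ⊙ C` generated by the elements
`a · α ⊗ c - a ⊗ α · c`. -/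
noncomputable def balancedIdeal (actA : CompatibleAction 𝔄 A) (actC : CompatibleAction 𝔄 C) :
    Submodule ℂ (A ⊗[ℂ] C) :=
  sInf {S | (∀ (α : 𝔄) (a : A) (c : C),
      actA.right a α ⊗ₜ[ℂ] c - a ⊗ₜ[ℂ] actC.left α c ∈ S) ∧
    ∀ t, ∀ s ∈ S, t * s ∈ S ∧ s * t ∈ S}

/-- The algebraic module tensor product `A ⊙_𝔄 C = (A ⊙ C) / I_{A,C}`. -/
abbrev ModuleTensor (actA : CompatibleAction 𝔄 A) (actC : CompatibleAction 𝔄 C) : Type _ :=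
  (A ⊗[ℂ] C) ⧸ balancedIdeal actA actC

/-- The quotient norm `‖x + I‖_γ = inf_{i ∈ I} ‖x + i‖_γ` on `A ⊙_𝔄 C`. -/
noncomputable def moduleTensorNorm (γ : TensorNormKind) {actA : CompatibleAction 𝔄 A}
    {actC : CompatibleAction 𝔄 C} (x : ModuleTensor actA actC) : ℝ≥0∞ :=
  ⨅ (y : A ⊗[ℂ] C) (_ : (balancedIdeal actA actC).mkQ y = x), cstarTensorNorm γ y

end ModuleTensor

/-- `u : A → B` is `𝔄`-`(γ → η)`-tensorizing: for every C*-algebra `C` with a compatible action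
of `𝔄`, the map `u ⊙ id_C` induces a map `u ⊙_𝔄 id_C : A ⊙_𝔄 C → B ⊙_𝔄 C`, and
`‖(u ⊙_𝔄 id_C)(x)‖_η ≤ ‖x‖_γ` for all `x` in `A ⊙_𝔄 C`. -/
def IsModuleTensorizing (γ η : TensorNormKind) {𝔄 : Type*} {A : Type u} {B : Type v}
    [NonUnitalCStarAlgebra 𝔄] [NonUnitalCStarAlgebra A] [NonUnitalCStarAlgebra B]
    (actA : CompatibleAction 𝔄 A) (actB : CompatibleAction 𝔄 B) (u : A →ₗ[ℂ] B) : Prop :=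
  ∀ (C : Type w) [NonUnitalCStarAlgebra C] (actC : CompatibleAction 𝔄 C),
    ∃ uC : ModuleTensor actA actC →ₗ[ℂ] ModuleTensor actB actC,
      (∀ x : A ⊗[ℂ] C, uC ((balancedIdeal actA actC).mkQ x) =
        (balancedIdeal actB actC).mkQ (TensorProduct.map u LinearMap.id x)) ∧
      ∀ x : ModuleTensor actA actC, moduleTensorNorm η (uC x) ≤ moduleTensorNorm γ x

/-! The estimate is proved on algebraic tensor products and then passes to the quotients by taking
infima, once `u ⊗ id` is known to map `I_{A,C}` into `I_{B,C}`.

Ideals: the involution turns left-triviality into `a · α = conj (f (α*)) a`, so the generators are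
`a ⊗ (conj (f (α*)) c - α · c)`. Let `J` be the set of `c` with `B ⊗ c ⊆ I_{B,C}`. It is an ideal of
`C`, because products span `B`. Hence `A ⊙ J` is an ideal containing the generators of `I_{A,C}`,
and `u ⊗ id` sends it into `I_{B,C}` (`balancedIdeal_le_comap`).

Minimal norm: for faithful `π`, the norm of `(π ⊗ σ)(x)` is the supremum of the norms in `M_m(A)` of
the compressions of `x` by orthonormal families in the space of `σ`. Compression turns `u ⊗ id` into
the entrywise action of `u`, so `‖u‖_cb ≤ 1` suffices (`minTensorNorm_map_le`).

Maximal norm: given a representation `ρ` of `B ⊙ C` and vectors `ξ, η`, a Stinespring form built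
from `ρ ∘ (u ⊗ id)` is positive, because Gram matrices are positive and `u` is completely positive.
Its GNS representation `Φ` of `A ⊙ C` satisfies `|⟪ξ, ρ((u ⊗ id) z) η⟫| ≤ ‖Φ z‖ ‖ξ‖ ‖η‖`
(`exists_dilation_bound`); approximate units replace the missing units. -/

/-! ### GNS construction for *-algebras acting by bounded operators -/

section GNS

open scoped InnerProductSpace ComplexOrder
open UniformSpace

/-- A *-algebra acting on a semi-inner product space by bounded operators which are compatible with
the involution acts on the Hilbert space completion. -/
theorem exists_representation_completion {D : Type*} [NonUnitalRing D] [StarRing D] [Module ℂ D]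
    {E : Type u} [SeminormedAddCommGroup E] [InnerProductSpace ℂ E]
    (T : D →ₗ[ℂ] E →L[ℂ] E) (hmul : ∀ d d' x, T (d * d') x = T d (T d' x))
    (hstar : ∀ d x y, ⟪T (star d) x, y⟫_ℂ = ⟪x, T d y⟫_ℂ) :
    ∃ Φ : D →⋆ₙₐ[ℂ] (Completion E →L[ℂ] Completion E),
      ∀ d (x : E), Φ d (x : Completion E) = (T d x : Completion E) := by
  have key : ∀ S S' : Completion E →L[ℂ] Completion E,
      (∀ x : E, S (x : Completion E) = S' (x : Completion E)) → S = S' := by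
    intro S S' h
    ext x
    induction x using Completion.induction_on with
    | hp => exact isClosed_eq (by fun_prop) (by fun_prop)
    | ih x => exact h x
  refine ⟨{ toFun := fun d => (T d).completion
            map_smul' := fun r d => key _ _ fun x => by simp
            map_zero' := key _ _ fun x => by simp [Completion.coe_zero]
            map_add' := fun d d' => key _ _ fun x => by simp [Completion.coe_add]
            map_mul' := fun d d' => key _ _ fun x => by simp [hmul]
            map_star' := fun d => ?_ }, fun d x => ?_⟩
  · refine (ContinuousLinearMap.eq_adjoint_iff _ _).mpr fun x y => ?_
    induction x, y using Completion.induction_on₂ with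
    | hp => exact isClosed_eq (by fun_prop) (by fun_prop)
    | ih x y => simp [hstar]
  · exact ContinuousLinearMap.completion_apply_coe _ _

/-- The Gelfand–Naimark–Segal construction for a *-algebra `D` acting on a space `E` with a positive
semidefinite form, when every element of `D` acts as a bounded operator. -/
theorem exists_gns_representation {D : Type*} [NonUnitalRing D] [StarRing D] [Module ℂ D]
    {E : Type u} [AddCommGroup E] [Module ℂ E] (c : PreInnerProductSpace.Core ℂ E)
    (L : D →ₗ[ℂ] E →ₗ[ℂ] E) (hmul : ∀ d d' x, L (d * d') x = L d (L d' x))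
    (hstar : ∀ d x y, c.inner (L (star d) x) y = c.inner x (L d y))
    (hbound : ∀ d, ∃ M : ℝ, ∀ x, (c.inner (L d x) (L d x)).re ≤ M * (c.inner x x).re) :
    ∃ (H : Type u) (_ : NormedAddCommGroup H) (_ : InnerProductSpace ℂ H) (_ : CompleteSpace H)
      (V : E →ₗ[ℂ] H) (Φ : D →⋆ₙₐ[ℂ] (H →L[ℂ] H)),
      (∀ x y, ⟪V x, V y⟫_ℂ = c.inner x y) ∧ ∀ d x, Φ d (V x) = V (L d x) := by
  let : SeminormedAddCommGroup E := InnerProductSpace.Core.toSeminormedAddCommGroup (c := c)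
  let : InnerProductSpace ℂ E := InnerProductSpace.ofCore c
  have hcont : ∀ d, ∃ M : ℝ, ∀ x, ‖L d x‖ ≤ M * ‖x‖ := by
    intro d
    obtain ⟨M, hM⟩ := hbound d
    -- A bound `M` may be negative when the form vanishes identically.
    refine ⟨√(max M 0), fun x => ?_⟩
    refine abs_le_of_sq_le_sq' ?_ (by positivity) |>.2
    rw [mul_pow, Real.sq_sqrt (le_max_right _ _), ← inner_self_eq_norm_sq (𝕜 := ℂ),
      ← inner_self_eq_norm_sq (𝕜 := ℂ)]
    exact (hM x).trans (mul_le_mul_of_nonneg_right (le_max_left _ _)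
      (inner_self_nonneg (𝕜 := ℂ) (x := x)))
  choose M hM using hcont
  let T : D →ₗ[ℂ] E →L[ℂ] E :=
    { toFun := fun d => (L d).mkContinuous (M d) (hM d)
      map_add' := fun d d' => ContinuousLinearMap.ext fun x => by
        change L (d + d') x = L d x + L d' x
        rw [map_add, LinearMap.add_apply]
      map_smul' := fun r d => ContinuousLinearMap.ext fun x => by
        change L (r • d) x = r • L d x
        rw [map_smul, LinearMap.smul_apply] }
  obtain ⟨Φ, hΦ⟩ := exists_representation_completion T hmul hstar
  exact ⟨Completion E, inferInstance, inferInstance, inferInstance,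
    (Completion.toComplL (𝕜 := ℂ) (E := E)).toLinearMap, Φ,
    fun x y => Completion.inner_coe x y, hΦ⟩

end GNS

/-! ### Positive functionals and faithful representations -/

section Faithful

open scoped ComplexOrder

variable {A : Type u} [NonUnitalCStarAlgebra A] [PartialOrder A] [StarOrderedRing A]

/-- Hahn–Banach separates `-a` from the closed real cone of positive elements; the real functional
is then complexified through real and imaginary parts. -/
theorem exists_positive_functional_ne_zero {a : A} (ha : 0 ≤ a) (ha0 : a ≠ 0) :
    ∃ φ : A →ₚ[ℂ] ℂ, φ a ≠ 0 := by
  let P : ProperCone ℝ A :=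
    { carrier := {x | 0 ≤ x}
      add_mem' := fun hx hy => add_nonneg hx hy
      zero_mem' := le_rfl
      smul_mem' := fun r x hx => smul_nonneg r.2 hx
      isClosed' := CStarAlgebra.isClosed_nonneg }
  have hna : -a ∉ P := fun h => ha0 (le_antisymm (neg_nonneg.mp h) ha)
  obtain ⟨g, hg, hga⟩ := P.hyperplane_separation_point hna
  let h : A →ₗ[ℂ] ℂ :=
    { toFun := fun x => (g (realPart x) : ℂ) + Complex.I * g (imaginaryPart x)
      map_add' := fun x y => by simp; ring
      map_smul' := fun r x => by
        simp [realPart_smul, imaginaryPart_smul]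
        apply Complex.ext <;> simp }
  have hh : ∀ x : A, 0 ≤ x → h x = g x := by
    intro x hx
    have hx' : IsSelfAdjoint x := .of_nonneg hx
    simp [h, hx'.imaginaryPart, hx'.coe_realPart]
  refine ⟨PositiveLinearMap.mk₀ h fun x hx => ?_, ?_⟩
  · rw [hh x hx]
    exact_mod_cast hg x hx
  · change h a ≠ 0
    rw [hh a ha]
    simp at hga
    exact_mod_cast hga.ne'

theorem star_mul_mul_self_le (x y : A) : star (x * y) * (x * y) ≤ ‖x‖ ^ 2 • (star y * y) := by
  have h := CStarAlgebra.star_left_conjugate_le_norm_smul (a := y) (b := star x * x)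
  rwa [CStarRing.norm_star_mul_self, ← sq, mul_assoc, mul_assoc, ← mul_assoc, ← star_mul] at h

theorem PositiveLinearMap.apply_conjugate_le (φ : A →ₚ[ℂ] ℂ) (d x : A) :
    (φ (star (d * x) * (d * x))).re ≤ ‖d‖ ^ 2 * (φ (star x * x)).re := by
  have h2 := (Complex.le_def.mp (OrderHomClass.mono φ (star_mul_mul_self_le d x))).1
  rwa [← Complex.coe_smul, map_smul, Complex.coe_smul, Complex.smul_re, smul_eq_mul] at h2

/-- The form `(x, y) ↦ ∑ i, φ i (xᵢ* yᵢ)` on finitely supported families in `A`. -/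
noncomputable abbrev directSumForm {ι : Type*} (φ : ι → A →ₚ[ℂ] ℂ) :
    PreInnerProductSpace.Core ℂ (ι →₀ A) where
  inner x y := x.sum fun i a => φ i (star a * y i)
  conj_inner_symm x y := by
    classical
    rw [Finsupp.sum_of_support_subset (s := x.support ∪ y.support) x Finset.subset_union_left _
        (by simp),
      Finsupp.sum_of_support_subset (s := x.support ∪ y.support) y Finset.subset_union_right _
        (by simp), map_sum]
    exact Finset.sum_congr rfl fun i _ => by simp [← Complex.star_def, ← map_star]
  re_inner_nonneg x := by
    rw [Finsupp.sum, map_sum]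
    exact Finset.sum_nonneg fun i _ =>
      (RCLike.nonneg_iff.mp ((φ i).map_nonneg (star_mul_self_nonneg _))).1
  add_left x y z := Finsupp.sum_add_index' (by simp) (by simp [add_mul])
  smul_left x y r := by
    rw [Finsupp.sum_smul_index' (by simp), Finsupp.sum, Finsupp.sum, Finset.mul_sum]
    simp [smul_mul_assoc]

theorem directSumForm_inner {ι : Type*} (φ : ι → A →ₚ[ℂ] ℂ) (x y : ι →₀ A) :
    (directSumForm φ).inner x y = x.sum fun i a => φ i (star a * y i) := rfl

variable (A) in
/-- The Gelfand–Naimark theorem: every C*-algebra has a faithful representation. -/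
theorem exists_faithful_representation :
    ∃ (H : Type u) (_ : NormedAddCommGroup H) (_ : InnerProductSpace ℂ H) (_ : CompleteSpace H)
      (π : A →⋆ₙₐ[ℂ] (H →L[ℂ] H)), Function.Injective π := by
  classical
  -- The functionals are indexed by `A` itself, so that the direct sum `A →₀ A` stays in the
  -- universe of `A`.
  have hex : ∀ a : A, ∃ φ : A →ₚ[ℂ] ℂ, 0 ≤ a → a ≠ 0 → φ a ≠ 0 := by
    intro a
    by_cases h : 0 ≤ a ∧ a ≠ 0
    · obtain ⟨φ, hφ⟩ := exists_positive_functional_ne_zero h.1 h.2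
      exact ⟨φ, fun _ _ => hφ⟩
    · exact ⟨0, fun h1 h2 => (h ⟨h1, h2⟩).elim⟩
  choose φ hφ using hex
  let L : A →ₗ[ℂ] (A →₀ A) →ₗ[ℂ] (A →₀ A) :=
    { toFun := fun d => Finsupp.mapRange.linearMap (LinearMap.mulLeft ℂ d)
      map_add' := fun d d' => by ext; simp [add_mul]
      map_smul' := fun r d => LinearMap.ext fun x => Finsupp.ext fun i => by
        simp [smul_mul_assoc] }
  have hL : ∀ d x i, L d x i = d * x i := fun d x i => by simp [L]
  have hsum : ∀ d x (y : A →₀ A), (directSumForm φ).inner (L d x) y =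
      x.sum fun i a => φ i (star (d * a) * y i) := by
    intro d x y
    exact Finsupp.sum_mapRange_index (hf := mul_zero d) (by simp)
  obtain ⟨H, i1, i2, i3, V, Φ, hV, hΦ⟩ := exists_gns_representation (directSumForm φ) L
    (fun d d' x => by ext i; simp [hL, mul_assoc])
    (fun d x y => by
      rw [hsum, directSumForm_inner]
      simp [hL, mul_assoc])
    (fun d => ⟨‖d‖ ^ 2, fun x => by
      rw [hsum, directSumForm_inner, Finsupp.sum, Finsupp.sum, Complex.re_sum, Complex.re_sum,
        Finset.mul_sum]
      exact Finset.sum_le_sum fun i _ => by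
        rw [hL]; exact (φ i).apply_conjugate_le d (x i)⟩)
  refine ⟨H, i1, i2, i3, Φ, (injective_iff_map_eq_zero Φ).mpr fun d hd => ?_⟩
  by_contra hd0
  -- Without a unit there is no cyclic vector at hand; `d` is tested on `d*`, placed in the summand
  -- whose functional does not vanish at `p* p`.
  set p := d * star d with hp
  have hp0 : p ≠ 0 := by simpa [hp, CStarRing.mul_star_self_eq_zero_iff] using hd0
  have hps : star p = p := by simp [hp]
  have hpp : star p * p ≠ 0 := by simpa [CStarRing.star_mul_self_eq_zero_iff] using hp0
  refine hφ _ (star_mul_self_nonneg p) hpp ?_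
  have h := hV (L d (Finsupp.single (star p * p) (star d))) (L d (Finsupp.single (star p * p) (star d)))
  rw [← hΦ, hd, zero_apply, inner_zero_left, hsum,
    Finsupp.sum_single_index (by simp), hL, Finsupp.single_eq_same] at h
  exact h.symm

end Faithful

/-! ### Representations of matrix algebras -/

section MatrixRepresentation

open scoped InnerProductSpace

variable {A : Type*} [NonUnitalCStarAlgebra A]
  {H : Type*} [NormedAddCommGroup H] [InnerProductSpace ℂ H] [CompleteSpace H] {n : Type*} [Fintype n]

/-- The operator on `H ^ n` given by an `n × n` matrix over `A` and a representation of `A`. -/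
noncomputable def matrixOperator (π : A →⋆ₙₐ[ℂ] (H →L[ℂ] H)) (N : CStarMatrix n n A) :
    PiLp 2 (fun _ : n => H) →L[ℂ] PiLp 2 (fun _ : n => H) :=
  (PiLp.continuousLinearEquiv 2 ℂ (fun _ : n => H)).symm.toContinuousLinearMap ∘L
    ContinuousLinearMap.pi fun k => ∑ j, π (N k j) ∘L PiLp.proj 2 (fun _ : n => H) j

theorem matrixOperator_apply (π : A →⋆ₙₐ[ℂ] (H →L[ℂ] H)) (N : CStarMatrix n n A)
    (x : PiLp 2 (fun _ : n => H)) (k : n) :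
    matrixOperator π N x k = ∑ j, π (N k j) (x j) := by
  simp [matrixOperator]

theorem inner_matrixOperator (π : A →⋆ₙₐ[ℂ] (H →L[ℂ] H)) (N : CStarMatrix n n A)
    (x y : PiLp 2 (fun _ : n => H)) :
    ⟪y, matrixOperator π N x⟫_ℂ = ∑ k, ∑ j, ⟪y k, π (N k j) (x j)⟫_ℂ := by
  simp [PiLp.inner_apply, matrixOperator_apply, inner_sum]

/-- The representation of `M_n(A)` on `H ^ n` induced by a representation of `A` on `H`. -/
noncomputable def matrixRepresentation (π : A →⋆ₙₐ[ℂ] (H →L[ℂ] H)) :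
    CStarMatrix n n A →⋆ₙₐ[ℂ] (PiLp 2 (fun _ : n => H) →L[ℂ] PiLp 2 (fun _ : n => H)) where
  toFun := matrixOperator π
  map_smul' r N := by
    ext x k
    simp [matrixOperator_apply, Finset.smul_sum]
  map_zero' := by
    ext x k
    simp [matrixOperator_apply]
  map_add' N N' := by
    ext x k
    simp [matrixOperator_apply, Finset.sum_add_distrib]
  map_mul' N N' := by
    ext x k
    simp only [matrixOperator_apply, mul_apply_eq_comp, CStarMatrix.mul_apply, map_sum,
      map_mul, sum_apply]
    rw [Finset.sum_comm]
  map_star' N := by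
    refine (ContinuousLinearMap.eq_adjoint_iff _ _).mpr fun x y => ?_
    rw [inner_matrixOperator, ← inner_conj_symm, inner_matrixOperator, map_sum, Finset.sum_comm]
    refine Finset.sum_congr rfl fun k _ => ?_
    rw [map_sum]
    refine Finset.sum_congr rfl fun j _ => ?_
    rw [inner_conj_symm, CStarMatrix.star_apply, map_star, ContinuousLinearMap.star_eq_adjoint,
      ContinuousLinearMap.adjoint_inner_left]

theorem matrixRepresentation_apply (π : A →⋆ₙₐ[ℂ] (H →L[ℂ] H)) (N : CStarMatrix n n A) :
    matrixRepresentation π N = matrixOperator π N := rfl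

theorem matrixRepresentation_injective {π : A →⋆ₙₐ[ℂ] (H →L[ℂ] H)} (hπ : Function.Injective π) :
    Function.Injective (matrixRepresentation (n := n) π) := by
  classical
  refine (injective_iff_map_eq_zero _).mpr fun N hN => ?_
  ext k j
  refine (map_eq_zero_iff π hπ).mp ?_
  ext x
  have h := congrArg (fun T => T (PiLp.single 2 j x) k) hN
  simpa [matrixRepresentation_apply, matrixOperator_apply, Pi.single_apply, apply_ite] using h

variable [PartialOrder A] [StarOrderedRing A]

theorem norm_matrixOperator_le (π : A →⋆ₙₐ[ℂ] (H →L[ℂ] H)) (N : CStarMatrix n n A) :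
    ‖matrixOperator π N‖ ≤ ‖N‖ :=
  NonUnitalStarAlgHom.norm_apply_le (matrixRepresentation π) N

theorem norm_matrixOperator {π : A →⋆ₙₐ[ℂ] (H →L[ℂ] H)} (hπ : Function.Injective π)
    (N : CStarMatrix n n A) : ‖matrixOperator π N‖ = ‖N‖ :=
  NonUnitalStarAlgHom.norm_map (matrixRepresentation π) (matrixRepresentation_injective hπ) N

end MatrixRepresentation

/-! ### Minimal norm via matrix compressions -/

section MinimalNorm

open scoped InnerProductSpace

/-- Both tensors lie in `H ⊗ F` for one finite-dimensional `F ⊆ K`. A common orthonormal family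
identifies them with vectors of `H ^ m`. -/
theorem exists_orthonormal_sum_tmul {H K : Type*} [NormedAddCommGroup H] [InnerProductSpace ℂ H]
    [NormedAddCommGroup K] [InnerProductSpace ℂ K] (x y : H ⊗[ℂ] K) :
    ∃ (m : ℕ) (e : Fin m → K) (h h' : PiLp 2 (fun _ : Fin m => H)), Orthonormal ℂ e ∧
      x = ∑ j, h j ⊗ₜ[ℂ] e j ∧ y = ∑ j, h' j ⊗ₜ[ℂ] e j := by
  obtain ⟨F, hF, hsub⟩ := TensorProduct.exists_finite_submodule_right_of_setFinite {x, y}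
    (Set.toFinite _)
  let b := stdOrthonormalBasis ℂ F
  have key : ∀ z : H ⊗[ℂ] F, ∃ h : PiLp 2 (fun _ : Fin (Module.finrank ℂ F) => H),
      F.subtype.lTensor H z = ∑ j, h j ⊗ₜ[ℂ] (b j : K) := by
    intro z
    induction z with
    | zero => exact ⟨0, by simp⟩
    | tmul v w =>
      refine ⟨WithLp.toLp 2 fun j => b.repr w j • v, ?_⟩
      conv_lhs => rw [← b.sum_repr w]
      simp [TensorProduct.tmul_sum, TensorProduct.smul_tmul]
    | add z z' hz hz' =>
      obtain ⟨h, hh⟩ := hz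
      obtain ⟨h', hh'⟩ := hz'
      exact ⟨h + h', by simp [hh, hh', TensorProduct.add_tmul, Finset.sum_add_distrib]⟩
  obtain ⟨z, hz⟩ := hsub (Set.mem_insert x _)
  obtain ⟨z', hz'⟩ := hsub (Set.mem_insert_of_mem x rfl)
  obtain ⟨h, hh⟩ := key z
  obtain ⟨h', hh'⟩ := key z'
  exact ⟨_, fun j => (b j : K), h, h', b.orthonormal.comp_linearIsometry F.subtypeₗᵢ,
    hz.symm.trans hh, hz'.symm.trans hh'⟩

theorem norm_sum_tmul_orthonormal {H K : Type*} [NormedAddCommGroup H] [InnerProductSpace ℂ H]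
    [NormedAddCommGroup K] [InnerProductSpace ℂ K] {m : ℕ} {e : Fin m → K} (he : Orthonormal ℂ e)
    (h : PiLp 2 (fun _ : Fin m => H)) : ‖∑ j, h j ⊗ₜ[ℂ] e j‖ = ‖h‖ := by
  classical
  refine (sq_eq_sq₀ (norm_nonneg _) (norm_nonneg _)).mp ?_
  rw [← inner_self_eq_norm_sq (𝕜 := ℂ), ← inner_self_eq_norm_sq (𝕜 := ℂ)]
  congr 1
  simp only [sum_inner, inner_sum, TensorProduct.inner_tmul, PiLp.inner_apply,
    orthonormal_iff_ite.mp he, mul_ite, mul_one, mul_zero, Finset.sum_ite_eq', Finset.mem_univ,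
    if_true]

/-- The slice map `a ⊗ c ↦ ω(c) a`. -/
noncomputable def sliceMap (A : Type*) {C : Type*} [AddCommGroup A] [Module ℂ A] [AddCommGroup C]
    [Module ℂ C] (ω : C →ₗ[ℂ] ℂ) : A ⊗[ℂ] C →ₗ[ℂ] A :=
  (TensorProduct.rid ℂ A).toLinearMap ∘ₗ ω.lTensor A

theorem sliceMap_tmul {A C : Type*} [AddCommGroup A] [Module ℂ A] [AddCommGroup C]
    [Module ℂ C] (ω : C →ₗ[ℂ] ℂ) (a : A) (c : C) : sliceMap A ω (a ⊗ₜ c) = ω c • a := by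
  simp [sliceMap]

theorem sliceMap_map {A B C : Type*} [AddCommGroup A] [Module ℂ A] [AddCommGroup B] [Module ℂ B]
    [AddCommGroup C] [Module ℂ C] (ω : C →ₗ[ℂ] ℂ) (u : A →ₗ[ℂ] B) (x : A ⊗[ℂ] C) :
    sliceMap B ω (TensorProduct.map u LinearMap.id x) = u (sliceMap A ω x) := by
  induction x with
  | zero => simp
  | tmul a c => simp [sliceMap_tmul]
  | add x y hx hy => simp [hx, hy]

variable {A : Type u} {B : Type v} {C : Type w} [NonUnitalCStarAlgebra A] [NonUnitalCStarAlgebra B]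
  [NonUnitalCStarAlgebra C]
  {H : Type*} [NormedAddCommGroup H] [InnerProductSpace ℂ H] [CompleteSpace H]
  {K : Type*} [NormedAddCommGroup K] [InnerProductSpace ℂ K] [CompleteSpace K]

theorem tensorRep_tmul (π : A →⋆ₙₐ[ℂ] (H →L[ℂ] H)) (σ : C →⋆ₙₐ[ℂ] (K →L[ℂ] K)) (a : A) (c : C)
    (ξ : H) (η : K) : tensorRep π σ (a ⊗ₜ c) (ξ ⊗ₜ η) = π a ξ ⊗ₜ σ c η := by
  simp [tensorRep]

/-- The functional `c ↦ ⟪η, σ(c) ξ⟫`. -/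
noncomputable def vectorFunctional (σ : C →⋆ₙₐ[ℂ] (K →L[ℂ] K)) (η ξ : K) : C →ₗ[ℂ] ℂ where
  toFun c := ⟪η, σ c ξ⟫_ℂ
  map_add' c c' := by simp
  map_smul' r c := by simp

/-- The compression of `x ∈ A ⊙ C` to a matrix over `A` by vectors of a representation of `C`. -/
noncomputable def compressionMatrix (σ : C →⋆ₙₐ[ℂ] (K →L[ℂ] K)) {m : ℕ} (e : Fin m → K)
    (x : A ⊗[ℂ] C) : CStarMatrix (Fin m) (Fin m) A :=
  CStarMatrix.ofMatrix fun k j => sliceMap A (vectorFunctional σ (e k) (e j)) x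

theorem compressionMatrix_apply (σ : C →⋆ₙₐ[ℂ] (K →L[ℂ] K)) {m : ℕ} (e : Fin m → K)
    (x : A ⊗[ℂ] C) (k j : Fin m) : compressionMatrix σ e x k j =
      sliceMap A (vectorFunctional σ (e k) (e j)) x := rfl

/-- Slicing touches only the factor `C` and `u` only the factor `A`. This is how the completely
bounded norm enters. -/
theorem compressionMatrix_map (σ : C →⋆ₙₐ[ℂ] (K →L[ℂ] K)) {m : ℕ} (e : Fin m → K)
    (u : A →ₗ[ℂ] B) (x : A ⊗[ℂ] C) :
    compressionMatrix σ e (TensorProduct.map u LinearMap.id x) = (compressionMatrix σ e x).map u :=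
  CStarMatrix.ext fun _ _ => sliceMap_map _ u x

theorem inner_tensorRep (π : A →⋆ₙₐ[ℂ] (H →L[ℂ] H)) (σ : C →⋆ₙₐ[ℂ] (K →L[ℂ] K)) {m : ℕ}
    (e : Fin m → K) (x : A ⊗[ℂ] C) (h h' : PiLp 2 (fun _ : Fin m => H)) :
    ⟪∑ k, h' k ⊗ₜ[ℂ] e k, tensorRep π σ x (∑ j, h j ⊗ₜ[ℂ] e j)⟫_ℂ =
      ⟪h', matrixOperator π (compressionMatrix σ e x) h⟫_ℂ := by
  rw [inner_matrixOperator]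
  simp only [map_sum, sum_inner, inner_sum]
  rw [Finset.sum_comm]
  refine Finset.sum_congr rfl fun k _ => Finset.sum_congr rfl fun j _ => ?_
  induction x with
  | zero => simp [compressionMatrix_apply]
  | tmul a c =>
    simp [compressionMatrix_apply, tensorRep_tmul, sliceMap_tmul, vectorFunctional, mul_comm]
  | add x y hx hy =>
    simp only [compressionMatrix_apply] at hx hy ⊢
    simp [inner_add_right, hx, hy]

theorem norm_le_of_norm_inner_le {E : Type*} [NormedAddCommGroup E] [InnerProductSpace ℂ E]
    (T : E →L[ℂ] E) {t : ℝ} (ht : 0 ≤ t) (h : ∀ x y, ‖⟪y, T x⟫_ℂ‖ ≤ t * ‖y‖ * ‖x‖) : ‖T‖ ≤ t := by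
  refine T.opNorm_le_bound ht fun x => ?_
  rcases (norm_nonneg (T x)).eq_or_lt with h0 | h0
  · rw [← h0]; positivity
  · have h1 := h x (T x)
    rw [inner_self_eq_norm_sq_to_K, norm_pow, RCLike.norm_ofReal, abs_norm] at h1
    nlinarith

variable [PartialOrder A] [StarOrderedRing A] [PartialOrder B] [StarOrderedRing B]

/-- With `norm_compressionMatrix_le` this computes the spatial norm from the compressions alone,
with no reference to the representation of `A`. -/
theorem norm_tensorRep_le (π : A →⋆ₙₐ[ℂ] (H →L[ℂ] H)) (σ : C →⋆ₙₐ[ℂ] (K →L[ℂ] K))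
    (x : A ⊗[ℂ] C) {t : ℝ} (ht : 0 ≤ t)
    (h : ∀ (m : ℕ) (e : Fin m → K), Orthonormal ℂ e → ‖compressionMatrix σ e x‖ ≤ t) :
    ‖tensorRep π σ x‖ ≤ t := by
  refine norm_le_of_norm_inner_le _ ht fun ξ η => ?_
  obtain ⟨m, e, v, v', he, rfl, rfl⟩ := exists_orthonormal_sum_tmul ξ η
  rw [inner_tensorRep, norm_sum_tmul_orthonormal he, norm_sum_tmul_orthonormal he]
  refine (norm_inner_le_norm _ _).trans ?_
  calc _ ≤ ‖v'‖ * (‖matrixOperator π (compressionMatrix σ e x)‖ * ‖v‖) := by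
        gcongr; exact ContinuousLinearMap.le_opNorm _ _
    _ ≤ ‖v'‖ * (t * ‖v‖) := by
        gcongr; exact (norm_matrixOperator_le _ _).trans (h m e he)
    _ = _ := by ring

theorem norm_compressionMatrix_le {π : A →⋆ₙₐ[ℂ] (H →L[ℂ] H)} (hπ : Function.Injective π)
    (σ : C →⋆ₙₐ[ℂ] (K →L[ℂ] K)) (x : A ⊗[ℂ] C) {m : ℕ} {e : Fin m → K} (he : Orthonormal ℂ e) :
    ‖compressionMatrix σ e x‖ ≤ ‖tensorRep π σ x‖ := by
  rw [← norm_matrixOperator hπ]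
  refine norm_le_of_norm_inner_le (matrixOperator π (compressionMatrix σ e x))
    (norm_nonneg (tensorRep π σ x)) fun v v' => ?_
  rw [← inner_tensorRep]
  refine (norm_inner_le_norm (𝕜 := ℂ) (E := H ⊗[ℂ] K) _ _).trans ?_
  calc _ ≤ ‖∑ k, v' k ⊗ₜ[ℂ] e k‖ * (‖tensorRep π σ x‖ * ‖∑ j, v j ⊗ₜ[ℂ] e j‖) := by
        gcongr; exact ContinuousLinearMap.le_opNorm _ _
    _ = _ := by
        rw [norm_sum_tmul_orthonormal he, norm_sum_tmul_orthonormal he]; ring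

theorem norm_cstarMatrix_map_le_of_cbNorm_le_one {u : A →ₗ[ℂ] B} (hu : cbNorm u ≤ 1) {n : ℕ}
    (M : CStarMatrix (Fin n) (Fin n) A) : ‖M.map u‖ ≤ ‖M‖ := by
  have h1 : ∀ M : CStarMatrix (Fin n) (Fin n) A, ‖M‖ ≤ 1 → ‖M.map u‖ ≤ 1 := by
    intro M hM
    have : ‖M.map u‖ₑ ≤ 1 := by
      refine le_trans ?_ hu
      unfold cbNorm
      exact le_iSup_of_le n <| le_iSup_of_le M <| le_iSup_of_le hM le_rfl
    rwa [← ofReal_norm, ENNReal.ofReal_le_one] at this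
  rcases eq_or_ne M 0 with rfl | hM
  · have : (0 : CStarMatrix (Fin n) (Fin n) A).map u = 0 := by ext; simp
    simp [this]
  · have hM0 : 0 < ‖M‖ := norm_pos_iff.mpr hM
    have h2 := h1 (((‖M‖⁻¹ : ℝ) : ℂ) • M) (by
      rw [norm_smul, Complex.norm_real, norm_inv, norm_norm, inv_mul_cancel₀ hM0.ne'])
    have h3 : (((‖M‖⁻¹ : ℝ) : ℂ) • M).map u = ((‖M‖⁻¹ : ℝ) : ℂ) • M.map u := by
      ext; simp
    rwa [h3, norm_smul, Complex.norm_real, norm_inv, norm_norm, inv_mul_le_iff₀ hM0, mul_one] at h2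

theorem minTensorNorm_map_le {u : A →ₗ[ℂ] B} (hu : cbNorm u ≤ 1) (x : A ⊗[ℂ] C) :
    minTensorNorm (TensorProduct.map u LinearMap.id x : B ⊗[ℂ] C) ≤ minTensorNorm x := by
  refine iSup_le fun H => iSup_le fun _ => iSup_le fun _ => iSup_le fun _ => iSup_le fun K =>
    iSup_le fun iK => iSup_le fun iK' => iSup_le fun iK'' => iSup_le fun π => iSup_le fun _ =>
    iSup_le fun σ => iSup_le fun hσ => ?_
  -- Keeping `σ`, a single faithful representation of `A` already gives a large enough term of the
  -- supremum.
  obtain ⟨H', i1, i2, i3, π', hπ'⟩ := exists_faithful_representation A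
  have h : ‖tensorRep π σ (TensorProduct.map u LinearMap.id x)‖ ≤ ‖tensorRep π' σ x‖ := by
    refine norm_tensorRep_le π σ _ (norm_nonneg (tensorRep π' σ x)) fun m e he => ?_
    rw [compressionMatrix_map]
    exact (norm_cstarMatrix_map_le_of_cbNorm_le_one hu _).trans
      (norm_compressionMatrix_le hπ' σ x he)
  refine le_trans (b := ‖tensorRep π' σ x‖ₑ) ?_ ?_
  · rw [← ofReal_norm, ← ofReal_norm]
    exact ENNReal.ofReal_le_ofReal h
  · unfold minTensorNorm
    exact le_iSup_of_le H' <| le_iSup_of_le i1 <| le_iSup_of_le i2 <| le_iSup_of_le i3 <|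
      le_iSup_of_le K <| le_iSup_of_le iK <| le_iSup_of_le iK' <| le_iSup_of_le iK'' <|
      le_iSup_of_le π' <| le_iSup_of_le hπ' <| le_iSup_of_le σ <| le_iSup_of_le hσ le_rfl

end MinimalNorm

theorem exists_eq_star_mul_self_of_nonneg {X : Type*} [NonUnitalCStarAlgebra X] [PartialOrder X]
    [StarOrderedRing X] {x : X} (hx : 0 ≤ x) : ∃ s, x = star s * s :=
  CStarAlgebra.nonneg_iff_eq_star_mul_self.mp hx

/-! ### Positivity and order bounds for Gram matrices -/

section GramMatrix

variable {A : Type*} [NonUnitalCStarAlgebra A] {κ : Type*}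

/-- The matrix with entries `(a p)* (a q)`. -/
def gramCStarMatrix (a : κ → A) : CStarMatrix κ κ A :=
  CStarMatrix.ofMatrix fun p q => star (a p) * a q

theorem gramCStarMatrix_apply (a : κ → A) (p q : κ) :
    gramCStarMatrix a p q = star (a p) * a q := rfl

open Classical in
/-- The matrix with `a` in row `r` and zeros elsewhere. -/
noncomputable def rowCStarMatrix (r : κ) (a : κ → A) : CStarMatrix κ κ A :=
  CStarMatrix.ofMatrix fun p q => if p = r then a q else 0

open Classical in
theorem rowCStarMatrix_apply (r : κ) (a : κ → A) (p q : κ) :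
    rowCStarMatrix r a p q = if p = r then a q else 0 := rfl

variable [Fintype κ]

theorem star_rowCStarMatrix_mul_self (r : κ) (a : κ → A) :
    star (rowCStarMatrix r a) * rowCStarMatrix r a = gramCStarMatrix a := by
  ext p q
  rw [CStarMatrix.mul_apply, Finset.sum_eq_single r]
  · simp [CStarMatrix.star_apply, rowCStarMatrix_apply, gramCStarMatrix_apply]
  · intro j _ hj
    simp [rowCStarMatrix_apply, hj]
  · simp

open Classical in
/-- The diagonal embedding of `A` into the matrices over `A`. -/
noncomputable def diagonalStarAlgHom (κ A : Type*) [NonUnitalCStarAlgebra A] [Fintype κ] :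
    A →⋆ₙₐ[ℂ] CStarMatrix κ κ A where
  toFun b := CStarMatrix.ofMatrix fun p q => if p = q then b else 0
  map_smul' r b := CStarMatrix.ext fun p q => by
    change (if p = q then r • b else 0) = r • (if p = q then b else 0)
    simp
  map_zero' := CStarMatrix.ext fun p q => by
    change (if p = q then (0 : A) else 0) = 0
    simp
  map_add' b b' := CStarMatrix.ext fun p q => by
    change (if p = q then b + b' else 0) = (if p = q then b else 0) + (if p = q then b' else 0)
    split_ifs <;> simp
  map_mul' b b' := CStarMatrix.ext fun p q => by
    rw [CStarMatrix.mul_apply]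
    change (if p = q then b * b' else 0) =
      ∑ j, (if p = j then b else 0) * (if j = q then b' else 0)
    simp
  map_star' b := CStarMatrix.ext fun p q => by
    rw [CStarMatrix.star_apply]
    change (if p = q then star b else 0) = star (if q = p then b else 0)
    simp only [eq_comm (a := q)]
    split_ifs <;> simp

theorem diagonalStarAlgHom_mul_rowCStarMatrix (r : κ) (b : A) (a : κ → A) :
    diagonalStarAlgHom κ A b * rowCStarMatrix r a = rowCStarMatrix r fun p => b * a p := by
  classical
  ext p q
  rw [CStarMatrix.mul_apply]
  change ∑ j, (if p = j then b else 0) * _ = _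
  simp [rowCStarMatrix_apply]

variable [PartialOrder A] [StarOrderedRing A]

theorem gramCStarMatrix_nonneg (a : κ → A) : 0 ≤ gramCStarMatrix a := by
  rcases isEmpty_or_nonempty κ with h | ⟨⟨r⟩⟩
  · exact (CStarMatrix.ext fun p => h.elim p : (0 : CStarMatrix κ κ A) = _).le
  · rw [← star_rowCStarMatrix_mul_self r]
    exact star_mul_self_nonneg _

/-- Left multiplication by `b` on a row is multiplication by a diagonal matrix, so
`star_mul_mul_self_le` applies in the matrix algebra. The diagonal embedding is contractive. -/
theorem exists_gramCStarMatrix_mul_le (a : κ → A) (b : A) :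
    ∃ M : ℝ, 0 ≤ M ∧ M ≤ ‖b‖ ^ 2 ∧
      gramCStarMatrix (fun p => b * a p) ≤ M • gramCStarMatrix a := by
  rcases isEmpty_or_nonempty κ with h | ⟨⟨r⟩⟩
  · exact ⟨0, le_rfl, by positivity, (CStarMatrix.ext fun p => h.elim p :
      gramCStarMatrix (fun p => b * a p) = _).le⟩
  · have h := star_mul_mul_self_le (diagonalStarAlgHom κ A b) (rowCStarMatrix r a)
    rw [diagonalStarAlgHom_mul_rowCStarMatrix, star_rowCStarMatrix_mul_self,
      star_rowCStarMatrix_mul_self] at h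
    exact ⟨_, by positivity, pow_le_pow_left₀ (norm_nonneg _)
      (NonUnitalStarAlgHom.norm_apply_le (diagonalStarAlgHom κ A) b) 2, h⟩

end GramMatrix

/-! ### Pairing positive matrices through a representation -/

section MatrixForm

open scoped InnerProductSpace

variable {B C : Type*} [NonUnitalCStarAlgebra B] [NonUnitalCStarAlgebra C]
  {H : Type*} [NormedAddCommGroup H] [InnerProductSpace ℂ H] [CompleteSpace H]
  {κ : Type*} [Fintype κ]

/-- The quantity `∑ p q, ⟪ζ p, ρ (P p q ⊗ Q p q) (ζ q)⟫`. -/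
noncomputable def matrixForm (ρ : B ⊗[ℂ] C →⋆ₙₐ[ℂ] (H →L[ℂ] H)) (ζ : κ → H)
    (P : CStarMatrix κ κ B) (Q : CStarMatrix κ κ C) : ℂ :=
  ∑ p, ∑ q, ⟪ζ p, ρ (P p q ⊗ₜ Q p q) (ζ q)⟫_ℂ

variable (ρ : B ⊗[ℂ] C →⋆ₙₐ[ℂ] (H →L[ℂ] H)) (ζ : κ → H)

theorem matrixForm_sub_left (P P' : CStarMatrix κ κ B) (Q : CStarMatrix κ κ C) :
    matrixForm ρ ζ (P - P') Q = matrixForm ρ ζ P Q - matrixForm ρ ζ P' Q := by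
  simp [matrixForm, TensorProduct.sub_tmul, Finset.sum_sub_distrib]

theorem matrixForm_sub_right (P : CStarMatrix κ κ B) (Q Q' : CStarMatrix κ κ C) :
    matrixForm ρ ζ P (Q - Q') = matrixForm ρ ζ P Q - matrixForm ρ ζ P Q' := by
  simp [matrixForm, TensorProduct.tmul_sub, Finset.sum_sub_distrib]

theorem matrixForm_smul_left (r : ℝ) (P : CStarMatrix κ κ B) (Q : CStarMatrix κ κ C) :
    matrixForm ρ ζ (r • P) Q = r * matrixForm ρ ζ P Q := by
  simp [matrixForm, ← Complex.coe_smul, ← TensorProduct.smul_tmul', Finset.mul_sum]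

theorem matrixForm_smul_right (r : ℝ) (P : CStarMatrix κ κ B) (Q : CStarMatrix κ κ C) :
    matrixForm ρ ζ P (r • Q) = r * matrixForm ρ ζ P Q := by
  simp [matrixForm, ← Complex.coe_smul, Finset.mul_sum]

variable [PartialOrder B] [StarOrderedRing B] [PartialOrder C] [StarOrderedRing C]

/-- A Schur product argument: with `P = N* N` and `Q = S* S` the form equals the sum over `k, l` of
`‖∑ p, ρ (N k p ⊗ S l p) (ζ p)‖ ^ 2`. -/
theorem re_matrixForm_nonneg {P : CStarMatrix κ κ B} {Q : CStarMatrix κ κ C} (hP : 0 ≤ P)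
    (hQ : 0 ≤ Q) : 0 ≤ (matrixForm ρ ζ P Q).re := by
  obtain ⟨N, rfl⟩ := exists_eq_star_mul_self_of_nonneg hP
  obtain ⟨S, rfl⟩ := exists_eq_star_mul_self_of_nonneg hQ
  have h : matrixForm ρ ζ (star N * N) (star S * S) =
      ∑ k, ∑ l, ⟪∑ p, ρ (N k p ⊗ₜ S l p) (ζ p), ∑ q, ρ (N k q ⊗ₜ S l q) (ζ q)⟫_ℂ := by
    have h1 : ∀ k l p q, ⟪ρ (N k p ⊗ₜ S l p) (ζ p), ρ (N k q ⊗ₜ S l q) (ζ q)⟫_ℂ =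
        ⟪ζ p, ρ ((star (N k p) * N k q) ⊗ₜ (star (S l p) * S l q)) (ζ q)⟫_ℂ := by
      intro k l p q
      rw [← ContinuousLinearMap.adjoint_inner_right, ← ContinuousLinearMap.star_eq_adjoint,
        ← map_star, TensorProduct.star_tmul, ← mul_apply_eq_comp, ← map_mul,
        Algebra.TensorProduct.tmul_mul_tmul]
    simp only [sum_inner, inner_sum, h1]
    simp only [matrixForm, CStarMatrix.mul_apply, CStarMatrix.star_apply, TensorProduct.sum_tmul,
      TensorProduct.tmul_sum, map_sum, sum_apply, inner_sum]
    have swap : ∀ g : κ → κ → κ → κ → ℂ,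
        ∑ p, ∑ q, ∑ l, ∑ k, g k l p q = ∑ k, ∑ l, ∑ q, ∑ p, g k l p q := by
      intro g
      calc _ = ∑ p, ∑ q, ∑ k, ∑ l, g k l p q :=
          Finset.sum_congr rfl fun p _ => Finset.sum_congr rfl fun q _ => Finset.sum_comm
        _ = ∑ p, ∑ k, ∑ q, ∑ l, g k l p q := Finset.sum_congr rfl fun p _ => Finset.sum_comm
        _ = ∑ k, ∑ p, ∑ q, ∑ l, g k l p q := Finset.sum_comm
        _ = ∑ k, ∑ p, ∑ l, ∑ q, g k l p q :=
          Finset.sum_congr rfl fun k _ => Finset.sum_congr rfl fun p _ => Finset.sum_comm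
        _ = ∑ k, ∑ l, ∑ p, ∑ q, g k l p q := Finset.sum_congr rfl fun k _ => Finset.sum_comm
        _ = _ := Finset.sum_congr rfl fun k _ => Finset.sum_congr rfl fun l _ => Finset.sum_comm
    exact swap fun k l p q =>
      ⟪ζ p, ρ ((star (N k p) * N k q) ⊗ₜ[ℂ] (star (S l p) * S l q)) (ζ q)⟫_ℂ
  rw [h, Complex.re_sum]
  refine Finset.sum_nonneg fun k _ => ?_
  rw [Complex.re_sum]
  exact Finset.sum_nonneg fun l _ => inner_self_nonneg (𝕜 := ℂ)

/-- The two matrices are replaced one at a time, each time pairing a positive difference with a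
positive matrix. -/
theorem re_matrixForm_mono {P P' : CStarMatrix κ κ B} {Q Q' : CStarMatrix κ κ C} {M M' : ℝ}
    (hM : 0 ≤ M) (hPP : P ≤ M • P') (hQQ : Q ≤ M' • Q') (hP' : 0 ≤ P') (hQ : 0 ≤ Q) :
    (matrixForm ρ ζ P Q).re ≤ M * M' * (matrixForm ρ ζ P' Q').re := by
  have h1 := re_matrixForm_nonneg ρ ζ (sub_nonneg.mpr hPP) hQ
  have h2 := re_matrixForm_nonneg ρ ζ hP' (sub_nonneg.mpr hQQ)
  rw [matrixForm_sub_left, matrixForm_smul_left, Complex.sub_re, Complex.re_ofReal_mul] at h1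
  rw [matrixForm_sub_right, matrixForm_smul_right, Complex.sub_re, Complex.re_ofReal_mul] at h2
  nlinarith [mul_nonneg hM h2]

/-- Order bounds control `ρ` only on products `b b' ⊗ c c'`. Taking `b' = b*`, `c' = c*` gives `‖T
T*‖ ≤ ‖b‖ ‖c‖ ‖T‖` for `T = ρ (b ⊗ c)`, and the C*-identity allows cancelling `‖T‖`. -/
theorem norm_apply_tmul_le (b : B) (c : C) : ‖ρ (b ⊗ₜ c)‖ ≤ ‖b‖ * ‖c‖ := by
  have hpos : ∀ {P : B} {Q : C} (η : H), 0 ≤ P → 0 ≤ Q → 0 ≤ (⟪η, ρ (P ⊗ₜ Q) η⟫_ℂ).re := by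
    intro P Q η hP hQ
    obtain ⟨s, rfl⟩ := exists_eq_star_mul_self_of_nonneg hP
    obtain ⟨t, rfl⟩ := exists_eq_star_mul_self_of_nonneg hQ
    rw [← Algebra.TensorProduct.tmul_mul_tmul, ← TensorProduct.star_tmul, map_mul, map_star,
      mul_apply_eq_comp, ContinuousLinearMap.star_eq_adjoint,
      ContinuousLinearMap.adjoint_inner_right]
    exact inner_self_nonneg (𝕜 := ℂ)
  have hsq : ∀ (b : B) (c : C) (η : H), ‖ρ (b ⊗ₜ c) η‖ ^ 2 =
      (⟪η, ρ ((star b * b) ⊗ₜ (star c * c)) η⟫_ℂ).re := by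
    intro b c η
    rw [← Algebra.TensorProduct.tmul_mul_tmul, ← TensorProduct.star_tmul, map_mul, map_star,
      mul_apply_eq_comp, ContinuousLinearMap.star_eq_adjoint,
      ContinuousLinearMap.adjoint_inner_right]
    exact (inner_self_eq_norm_sq (𝕜 := ℂ) _).symm
  have hstep : ∀ (b' : B) (c' : C) (η : H),
      ‖ρ ((b * b') ⊗ₜ (c * c')) η‖ ≤ ‖b‖ * ‖c‖ * ‖ρ (b' ⊗ₜ c') η‖ := by
    intro b' c' η
    refine abs_le_of_sq_le_sq' ?_ (by positivity) |>.2
    have h1 := hpos η (sub_nonneg.mpr (star_mul_mul_self_le b b')) (star_mul_self_nonneg (c * c'))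
    have h2 := hpos η (star_mul_self_nonneg b') (sub_nonneg.mpr (star_mul_mul_self_le c c'))
    rw [TensorProduct.sub_tmul, ← Complex.coe_smul, ← TensorProduct.smul_tmul', map_sub, map_smul,
      sub_apply, inner_sub_right, smul_apply, inner_smul_right,
      Complex.sub_re, Complex.re_ofReal_mul, ← hsq, ← hsq] at h1
    rw [TensorProduct.tmul_sub, ← Complex.coe_smul, TensorProduct.tmul_smul, map_sub, map_smul,
      sub_apply, inner_sub_right, smul_apply, inner_smul_right,
      Complex.sub_re, Complex.re_ofReal_mul, ← hsq, ← hsq] at h2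
    nlinarith [mul_nonneg (sq_nonneg ‖b‖) h2]
  set T := ρ (b ⊗ₜ c) with hT
  have hTT : ‖T * star T‖ ≤ ‖b‖ * ‖c‖ * ‖T‖ := by
    refine ContinuousLinearMap.opNorm_le_bound _ (by positivity) fun η => ?_
    have h := hstep (star b) (star c) η
    rw [← Algebra.TensorProduct.tmul_mul_tmul, ← TensorProduct.star_tmul, map_mul, map_star] at h
    refine h.trans ?_
    rw [mul_assoc _ ‖T‖]
    gcongr
    exact ((star T).le_opNorm η).trans_eq (by rw [norm_star])
  rw [CStarRing.norm_self_mul_star] at hTT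
  rcases (norm_nonneg T).eq_or_lt with h0 | h0
  · rw [← h0]; positivity
  · exact le_of_mul_le_mul_right hTT h0

end MatrixForm

/-! ### Maximal norm via Stinespring dilation -/

section MaximalNorm

open scoped InnerProductSpace
open Filter Topology

theorem PreInnerProductSpace.Core.re_inner_add_self_le {E : Type*} [AddCommGroup E] [Module ℂ E]
    (c : PreInnerProductSpace.Core ℂ E) (x y : E) :
    (c.inner (x + y) (x + y)).re ≤ 2 * (c.inner x x).re + 2 * (c.inner y y).re := by
  let : SeminormedAddCommGroup E := InnerProductSpace.Core.toSeminormedAddCommGroup (c := c)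
  let : InnerProductSpace ℂ E := InnerProductSpace.ofCore c
  have h : ∀ z, (c.inner z z).re = ‖z‖ ^ 2 := fun z => inner_self_eq_norm_sq (𝕜 := ℂ) z
  rw [h, h, h]
  nlinarith [norm_add_le x y, norm_nonneg (x + y), norm_nonneg x, norm_nonneg y,
    sq_nonneg (‖x‖ - ‖y‖), pow_le_pow_left₀ (norm_nonneg (x + y)) (norm_add_le x y) 2]

theorem tensorMap_star {A B C : Type*} [NonUnitalCStarAlgebra A] [NonUnitalCStarAlgebra B]
    [NonUnitalCStarAlgebra C] {u : A →ₗ[ℂ] B} (hu : ∀ a, u (star a) = star (u a)) (x : A ⊗[ℂ] C) :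
    TensorProduct.map u LinearMap.id (star x) = star (TensorProduct.map u LinearMap.id x) := by
  induction x with
  | zero => simp
  | tmul a c => simp [hu]
  | add x y hx hy => simp [hx, hy]

/-- The form `(x, y) ↦ ∑ i j, ⟪ξ i, ρ ((u ⊗ id) (xᵢ* yⱼ)) (ξ j)⟫` on families in `A ⊙ C`. -/
noncomputable def dilationInner {A B C : Type*} [NonUnitalCStarAlgebra A] [NonUnitalCStarAlgebra B]
    [NonUnitalCStarAlgebra C] {H : Type*} [NormedAddCommGroup H] [InnerProductSpace ℂ H]
    [CompleteSpace H] {ι : Type*} [Fintype ι] (ρ : B ⊗[ℂ] C →⋆ₙₐ[ℂ] (H →L[ℂ] H)) (u : A →ₗ[ℂ] B)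
    (ξ : ι → H) (x y : ι → A ⊗[ℂ] C) : ℂ :=
  ∑ i, ∑ j, ⟪ξ i, ρ (TensorProduct.map u LinearMap.id (star (x i) * y j)) (ξ j)⟫_ℂ

variable {A : Type u} {B : Type v} {C : Type w} [NonUnitalCStarAlgebra A]
  [NonUnitalCStarAlgebra B] [NonUnitalCStarAlgebra C]
  {H : Type*} [NormedAddCommGroup H] [InnerProductSpace ℂ H] [CompleteSpace H]
  {ι : Type*}

theorem exists_family_sum_tmul (x : ι → A ⊗[ℂ] C) :
    ∃ (n : ι → ℕ) (a : (Σ i, Fin (n i)) → A) (c : (Σ i, Fin (n i)) → C),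
      ∀ i, x i = ∑ k, a ⟨i, k⟩ ⊗ₜ c ⟨i, k⟩ := by
  choose n a c h using fun i => TensorProduct.exists_sum_tmul_eq (x i)
  exact ⟨n, fun p => a p.1 p.2, fun p => c p.1 p.2, h⟩

variable [Fintype ι] (ρ : B ⊗[ℂ] C →⋆ₙₐ[ℂ] (H →L[ℂ] H)) (ξ : ι → H)

/-- Merging the expansions of all `x i` into one family over a sigma type makes the form a pairing
of two Gram matrices. -/
theorem dilationInner_self_eq_matrixForm (u : A →ₗ[ℂ] B) {n : ι → ℕ} (a : (Σ i, Fin (n i)) → A)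
    (c : (Σ i, Fin (n i)) → C) {x : ι → A ⊗[ℂ] C} (hx : ∀ i, x i = ∑ k, a ⟨i, k⟩ ⊗ₜ c ⟨i, k⟩) :
    dilationInner ρ u ξ x x =
      matrixForm ρ (fun p => ξ p.1) ((gramCStarMatrix a).map u) (gramCStarMatrix c) := by
  simp only [dilationInner, matrixForm, Fintype.sum_sigma, hx, star_sum, Finset.sum_mul_sum,
    TensorProduct.star_tmul, Algebra.TensorProduct.tmul_mul_tmul, map_sum, sum_apply, inner_sum,
    TensorProduct.map_tmul, CStarMatrix.map_apply, gramCStarMatrix_apply, LinearMap.id_apply]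
  exact Finset.sum_congr rfl fun i _ => Finset.sum_comm

variable [PartialOrder A] [StarOrderedRing A] [PartialOrder B] [StarOrderedRing B] [PartialOrder C]
  [StarOrderedRing C] (φ : CompletelyPositiveMap A B)

/-- `dilationInner` as a positive semidefinite form, for a completely positive map. -/
noncomputable abbrev dilationForm : PreInnerProductSpace.Core ℂ (ι → A ⊗[ℂ] C) where
  inner := dilationInner ρ φ.toLinearMap ξ
  conj_inner_symm x y := by
    have hstar : ∀ a, φ.toLinearMap (star a) = star (φ.toLinearMap a) := fun a => map_star φ a
    simp only [dilationInner, map_sum]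
    rw [Finset.sum_comm]
    refine Finset.sum_congr rfl fun i _ => Finset.sum_congr rfl fun j _ => ?_
    rw [inner_conj_symm, ← ContinuousLinearMap.adjoint_inner_right,
      ← ContinuousLinearMap.star_eq_adjoint, ← map_star, ← tensorMap_star hstar, star_mul,
      star_star]
  re_inner_nonneg x := by
    obtain ⟨n, a, c, h⟩ := exists_family_sum_tmul x
    rw [dilationInner_self_eq_matrixForm ρ ξ φ.toLinearMap a c h]
    exact re_matrixForm_nonneg ρ _ (φ.map_cstarMatrix_nonneg _ (gramCStarMatrix_nonneg a))
      (gramCStarMatrix_nonneg c)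
  add_left x y z := by
    simp [dilationInner, add_mul, Finset.sum_add_distrib]
  smul_left x y r := by
    simp [dilationInner, smul_mul_assoc, Finset.mul_sum]

theorem dilationForm_inner (x y : ι → A ⊗[ℂ] C) :
    (dilationForm ρ ξ φ).inner x y = dilationInner ρ φ.toLinearMap ξ x y := rfl

theorem CompletelyPositiveMap.map_gramCStarMatrix_mul_le {κ : Type*} [Fintype κ] (a : κ → A)
    (b : A) : ∃ M : ℝ, 0 ≤ M ∧ M ≤ ‖b‖ ^ 2 ∧
      (gramCStarMatrix fun p => b * a p).map φ ≤ M • (gramCStarMatrix a).map φ := by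
  obtain ⟨M, hM, hM', h⟩ := exists_gramCStarMatrix_mul_le a b
  refine ⟨M, hM, hM', sub_nonneg.mp ?_⟩
  convert φ.map_cstarMatrix_nonneg _ (sub_nonneg.mpr h) using 1
  ext p q
  simp [← Complex.coe_smul]

/-- On an elementary tensor the Gram bounds in `A` and `C` multiply; sums cost a factor 2 by
`re_inner_add_self_le`. -/
theorem exists_dilationForm_mul_le (d : A ⊗[ℂ] C) : ∃ M : ℝ, ∀ x : ι → A ⊗[ℂ] C,
    ((dilationForm ρ ξ φ).inner (fun i => d * x i) (fun i => d * x i)).re ≤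
      M * ((dilationForm ρ ξ φ).inner x x).re := by
  induction d with
  | zero => exact ⟨0, fun x => by simp [dilationForm_inner, dilationInner]⟩
  | tmul b c =>
    refine ⟨‖b‖ ^ 2 * ‖c‖ ^ 2, fun x => ?_⟩
    obtain ⟨n, a, e, h⟩ := exists_family_sum_tmul x
    have h' : ∀ i, b ⊗ₜ c * x i = ∑ k, (fun p => b * a p) ⟨i, k⟩ ⊗ₜ (fun p => c * e p) ⟨i, k⟩ := by
      intro i
      simp [h, Finset.mul_sum]
    rw [dilationForm_inner, dilationForm_inner,
      dilationInner_self_eq_matrixForm ρ ξ φ.toLinearMap (fun p => b * a p) (fun p => c * e p) h',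
      dilationInner_self_eq_matrixForm ρ ξ φ.toLinearMap _ _ h]
    obtain ⟨M, hM, hMb, h1⟩ := φ.map_gramCStarMatrix_mul_le a b
    obtain ⟨M', hM', hMc, h2⟩ := exists_gramCStarMatrix_mul_le e c
    have hpos := φ.map_cstarMatrix_nonneg _ (gramCStarMatrix_nonneg a)
    refine (re_matrixForm_mono ρ _ hM h1 h2 hpos (gramCStarMatrix_nonneg _)).trans ?_
    exact mul_le_mul_of_nonneg_right (mul_le_mul hMb hMc hM' (by positivity))
      (re_matrixForm_nonneg ρ _ hpos (gramCStarMatrix_nonneg _))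
  | add d d' hd hd' =>
    obtain ⟨M, hM⟩ := hd
    obtain ⟨M', hM'⟩ := hd'
    refine ⟨2 * M + 2 * M', fun x => ?_⟩
    have h := (dilationForm ρ ξ φ).re_inner_add_self_le (fun i => d * x i) (fun i => d' * x i)
    have h1 : (fun i => (d + d') * x i) = (fun i => d * x i) + fun i => d' * x i :=
      funext fun i => add_mul d d' (x i)
    rw [h1]
    linarith [hM x, hM' x]

/-- A Stinespring-type dilation of `ρ ∘ (φ ⊗ id)` at two vectors, on a space which is as small as
`A ⊙ C`. -/
theorem exists_dilation_bound_conjugate (hφ : ∀ a, ‖φ a‖ ≤ ‖a‖) (ξ η : H) :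
    ∃ (H' : Type (max u w)) (_ : NormedAddCommGroup H') (_ : InnerProductSpace ℂ H')
      (_ : CompleteSpace H') (Φ : A ⊗[ℂ] C →⋆ₙₐ[ℂ] (H' →L[ℂ] H')),
      ∀ (z : A ⊗[ℂ] C) (e : A) (f : C), ‖e‖ ≤ 1 → ‖f‖ ≤ 1 →
        ‖⟪ξ, ρ (TensorProduct.map φ.toLinearMap LinearMap.id (star (e ⊗ₜ f) * (z * e ⊗ₜ f))) η⟫_ℂ‖ ≤
          ‖Φ z‖ * ‖ξ‖ * ‖η‖ := by
  -- Two vectors instead of all of `H` keep the dilation space in the universe over which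
  -- `maxTensorNorm` on `A ⊙ C` ranges.
  let ζ : Fin 2 → H := ![ξ, η]
  let L : A ⊗[ℂ] C →ₗ[ℂ] (Fin 2 → A ⊗[ℂ] C) →ₗ[ℂ] (Fin 2 → A ⊗[ℂ] C) :=
    { toFun := fun d => LinearMap.compLeft (LinearMap.mulLeft ℂ d) (Fin 2)
      map_add' := fun d d' => LinearMap.ext fun x => funext fun i => add_mul d d' (x i)
      map_smul' := fun r d => LinearMap.ext fun x => funext fun i => smul_mul_assoc r d (x i) }
  have hL : ∀ d x, L d x = fun i => d * x i := fun _ _ => rfl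
  obtain ⟨H', i1, i2, i3, V, Φ, hV, hΦ⟩ := exists_gns_representation (dilationForm ρ ζ φ) L
    (fun d d' x => funext fun i => mul_assoc d d' (x i))
    (fun d x y => by simp [hL, dilationForm_inner, dilationInner, mul_assoc])
    (fun d => exists_dilationForm_mul_le ρ ζ φ d)
  refine ⟨H', i1, i2, i3, Φ, fun z e f he hf => ?_⟩
  have hsingle : ∀ (i j : Fin 2) (s t : A ⊗[ℂ] C),
      ⟪V (Pi.single i s), V (Pi.single j t)⟫_ℂ =
        ⟪ζ i, ρ (TensorProduct.map φ.toLinearMap LinearMap.id (star s * t)) (ζ j)⟫_ℂ := by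
    intro i j s t
    rw [hV]
    change dilationInner ρ φ.toLinearMap ζ _ _ = _
    rw [dilationInner, Finset.sum_eq_single i, Finset.sum_eq_single j]
    · simp
    · intro k _ hk
      simp [hk]
    · simp
    · intro k _ hk
      simp [hk]
    · simp
  have hnorm : ∀ i, ‖V (Pi.single i (e ⊗ₜ f))‖ ≤ ‖ζ i‖ := by
    intro i
    refine abs_le_of_sq_le_sq' ?_ (norm_nonneg _) |>.2
    rw [← inner_self_eq_norm_sq (𝕜 := ℂ), hsingle]
    refine (RCLike.re_le_norm _).trans ((norm_inner_le_norm _ _).trans ?_)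
    rw [sq]
    gcongr
    refine (ContinuousLinearMap.le_opNorm _ _).trans (mul_le_of_le_one_left (norm_nonneg _) ?_)
    rw [TensorProduct.star_tmul, Algebra.TensorProduct.tmul_mul_tmul, TensorProduct.map_tmul]
    refine (norm_apply_tmul_le ρ _ _).trans ?_
    refine mul_le_one₀ ((hφ _).trans ?_) (norm_nonneg _) ?_
    · rw [CStarRing.norm_star_mul_self]; exact mul_le_one₀ he (norm_nonneg _) he
    · rw [LinearMap.id_apply, CStarRing.norm_star_mul_self]
      exact mul_le_one₀ hf (norm_nonneg _) hf
  have hz : L z (Pi.single 1 (e ⊗ₜ f)) = Pi.single 1 (z * e ⊗ₜ f) := by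
    rw [hL]
    exact (Pi.single_op (fun _ t => z * t) (fun _ => mul_zero z) 1 (e ⊗ₜ f)).symm
  -- With `e ⊗ f` standing in for `1 ⊗ 1`, the quantity is a coefficient of `Φ z` between vectors of
  -- length at most `‖ξ‖` and `‖η‖`.
  have key := hsingle 0 1 (e ⊗ₜ f) (z * e ⊗ₜ f)
  rw [← hz, ← hΦ] at key
  change _ = ⟪ξ, _⟫_ℂ at key
  rw [show ζ 1 = η from rfl] at key
  rw [← key]
  refine (norm_inner_le_norm _ _).trans ?_
  calc _ ≤ ‖ξ‖ * (‖Φ z‖ * ‖η‖) := by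
        gcongr
        · exact hnorm 0
        · exact (ContinuousLinearMap.le_opNorm _ _).trans
            (mul_le_mul_of_nonneg_left (hnorm 1) (norm_nonneg _))
    _ = _ := by ring

theorem tendsto_star_mul_mul_approximateUnit (a : A) :
    Tendsto (fun e => star e * (a * e)) (CStarAlgebra.approximateUnit A) (𝓝 a) := by
  have hl := CStarAlgebra.increasingApproximateUnit A
  have h1 : Tendsto (fun e => ‖a * e - a‖ + ‖e * a - a‖) (CStarAlgebra.approximateUnit A)
      (𝓝 0) := by
    have h := (tendsto_iff_norm_sub_tendsto_zero.mp (hl.tendsto_mul_left a)).add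
      (tendsto_iff_norm_sub_tendsto_zero.mp (hl.tendsto_mul_right a))
    simpa using h
  refine tendsto_iff_norm_sub_tendsto_zero.mpr
    (squeeze_zero' (Eventually.of_forall fun _ => norm_nonneg _) ?_ h1)
  filter_upwards [hl.eventually_star_eq, hl.eventually_norm] with e he hn
  rw [he, show e * (a * e) - a = e * (a * e - a) + (e * a - a) by rw [mul_sub]; abel]
  refine (norm_add_le _ _).trans (add_le_add_left ((norm_mul_le _ _).trans ?_) _)
  exact mul_le_of_le_one_left (norm_nonneg _) hn

/-- By linearity `z` may be elementary; there `(a, c) ↦ ρ (φ a ⊗ c)` is jointly continuous by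
`norm_apply_tmul_le`. -/
theorem tendsto_apply_map_conjugate (hφ : ∀ a, ‖φ a‖ ≤ ‖a‖) (z : A ⊗[ℂ] C) :
    Tendsto (fun p : A × C => ρ (TensorProduct.map φ.toLinearMap LinearMap.id
        (star (p.1 ⊗ₜ p.2) * (z * p.1 ⊗ₜ p.2))))
      (CStarAlgebra.approximateUnit A ×ˢ CStarAlgebra.approximateUnit C)
      (𝓝 (ρ (TensorProduct.map φ.toLinearMap LinearMap.id z))) := by
  induction z with
  | zero => simp
  | tmul a c =>
    let β : A →L[ℂ] C →L[ℂ] (H →L[ℂ] H) := LinearMap.mkContinuous₂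
      (LinearMap.mk₂ ℂ (fun a c => ρ (φ a ⊗ₜ c))
        (fun a a' c => by simp [TensorProduct.add_tmul])
        (fun r a c => by simp [← TensorProduct.smul_tmul'])
        (fun a c c' => by simp [TensorProduct.tmul_add])
        (fun r a c => by simp)) 1 fun a c => by
          rw [one_mul]
          exact (norm_apply_tmul_le ρ _ _).trans
            (mul_le_mul_of_nonneg_right (hφ a) (norm_nonneg _))
    have h1 := (tendsto_star_mul_mul_approximateUnit a).comp
      (tendsto_fst (g := CStarAlgebra.approximateUnit C))
    have h2 := (tendsto_star_mul_mul_approximateUnit c).comp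
      (tendsto_snd (f := CStarAlgebra.approximateUnit A))
    refine ((β.continuous₂.tendsto (a, c)).comp (h1.prodMk_nhds h2)).congr fun p => ?_
    rw [TensorProduct.star_tmul, Algebra.TensorProduct.tmul_mul_tmul,
      Algebra.TensorProduct.tmul_mul_tmul, TensorProduct.map_tmul]
    rfl
  | add z z' hz hz' =>
    simpa only [add_mul, mul_add, map_add] using hz.add hz'

/-- `Φ` does not depend on `e` and `f`, so the bound survives the limit along approximate units. -/
theorem exists_dilation_bound (hφ : ∀ a, ‖φ a‖ ≤ ‖a‖) (ξ η : H) :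
    ∃ (H' : Type (max u w)) (_ : NormedAddCommGroup H') (_ : InnerProductSpace ℂ H')
      (_ : CompleteSpace H') (Φ : A ⊗[ℂ] C →⋆ₙₐ[ℂ] (H' →L[ℂ] H')), ∀ z : A ⊗[ℂ] C,
        ‖⟪ξ, ρ (TensorProduct.map φ.toLinearMap LinearMap.id z) η⟫_ℂ‖ ≤ ‖Φ z‖ * ‖ξ‖ * ‖η‖ := by
  obtain ⟨H', i1, i2, i3, Φ, h⟩ := exists_dilation_bound_conjugate ρ φ hφ ξ η
  refine ⟨H', i1, i2, i3, Φ, fun z => ?_⟩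
  have hcont : Continuous fun T : H →L[ℂ] H => ‖⟪ξ, T η⟫_ℂ‖ := by fun_prop
  refine le_of_tendsto ((hcont.tendsto _).comp (tendsto_apply_map_conjugate ρ φ hφ z)) ?_
  filter_upwards [(CStarAlgebra.increasingApproximateUnit A).eventually_norm.prod_mk
    (CStarAlgebra.increasingApproximateUnit C).eventually_norm] with p hp
  exact h z p.1 p.2 hp.1 hp.2

theorem maxTensorNorm_map_le (hφ : ∀ a, ‖φ a‖ ≤ ‖a‖) (x : A ⊗[ℂ] C) :
    maxTensorNorm (TensorProduct.map φ.toLinearMap LinearMap.id x : B ⊗[ℂ] C) ≤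
      maxTensorNorm x := by
  refine iSup_le fun H => iSup_le fun _ => iSup_le fun _ => iSup_le fun _ => iSup_le fun ρ => ?_
  rcases eq_or_ne (maxTensorNorm x) ⊤ with htop | htop
  · rw [htop]; exact le_top
  rw [← ofReal_norm]
  refine ENNReal.ofReal_le_of_le_toReal ?_
  refine norm_le_of_norm_inner_le _ ENNReal.toReal_nonneg fun η ξ => ?_
  -- `Φ` varies with the two vectors, but `‖Φ x‖` is always at most the maximal norm of `x`.
  obtain ⟨H', i1, i2, i3, Φ, h⟩ := exists_dilation_bound ρ φ hφ ξ η
  refine (h x).trans ?_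
  gcongr
  refine (ENNReal.ofReal_le_iff_le_toReal htop).mp ?_
  rw [ofReal_norm]
  unfold maxTensorNorm
  exact le_iSup_of_le H' <| le_iSup_of_le i1 <| le_iSup_of_le i2 <| le_iSup_of_le i3 <|
    le_iSup_of_le Φ le_rfl

end MaximalNorm

/-! ### The balanced ideals and passage to quotients -/

section Ideal

theorem mem_span_mul {B : Type*} [NonUnitalCStarAlgebra B] [PartialOrder B] [StarOrderedRing B]
    (b : B) : b ∈ Submodule.span ℂ (Set.range fun p : B × B => p.1 * p.2) := by
  have h : b ∈ Submodule.span ℂ {x : B | 0 ≤ x} := by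
    rw [CStarAlgebra.span_nonneg]; exact Submodule.mem_top
  refine Submodule.span_mono (fun x hx => ?_) h
  obtain ⟨s, rfl⟩ := exists_eq_star_mul_self_of_nonneg hx
  exact ⟨(star s, s), rfl⟩

variable {𝔄 : Type*} {A : Type u} {B : Type v} {C : Type w} [NonUnitalCStarAlgebra 𝔄]
  [NonUnitalCStarAlgebra A] [NonUnitalCStarAlgebra B] [NonUnitalCStarAlgebra C]

theorem CompatibleAction.IsLeftTrivial.right_eq {act : CompatibleAction 𝔄 A}
    {f : WeakDual.characterSpace ℂ 𝔄} (h : act.IsLeftTrivial f) (α : 𝔄) (a : A) :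
    act.right a α = star (f (star α)) • a := by
  have h1 := act.star_left (star α) (star a)
  rw [star_star, star_star] at h1
  rw [← h1, h, star_smul, star_star]

theorem generator_mem_balancedIdeal (actA : CompatibleAction 𝔄 A) (actC : CompatibleAction 𝔄 C)
    (α : 𝔄) (a : A) (c : C) :
    actA.right a α ⊗ₜ[ℂ] c - a ⊗ₜ[ℂ] actC.left α c ∈ balancedIdeal actA actC :=
  Submodule.mem_sInf.mpr fun _ hS => hS.1 α a c

theorem mul_mem_balancedIdeal {actA : CompatibleAction 𝔄 A} {actC : CompatibleAction 𝔄 C}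
    {s : A ⊗[ℂ] C} (hs : s ∈ balancedIdeal actA actC) (t : A ⊗[ℂ] C) :
    t * s ∈ balancedIdeal actA actC ∧ s * t ∈ balancedIdeal actA actC :=
  ⟨Submodule.mem_sInf.mpr fun S hS => (hS.2 t s (Submodule.mem_sInf.mp hs S hS)).1,
    Submodule.mem_sInf.mpr fun S hS => (hS.2 t s (Submodule.mem_sInf.mp hs S hS)).2⟩

/-- The subspace of all `c` with `b ⊗ c ∈ I_{B,C}` for every `b`. -/
def balancedFiber (actB : CompatibleAction 𝔄 B) (actC : CompatibleAction 𝔄 C) :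
    Submodule ℂ C where
  carrier := {c | ∀ b : B, b ⊗ₜ[ℂ] c ∈ balancedIdeal actB actC}
  add_mem' hc hc' b := by
    rw [TensorProduct.tmul_add]
    exact add_mem (hc b) (hc' b)
  zero_mem' b := by simp
  smul_mem' r c hc b := by
    rw [TensorProduct.tmul_smul]
    exact Submodule.smul_mem _ r (hc b)

theorem smul_sub_left_mem_balancedFiber {actB : CompatibleAction 𝔄 B}
    {f : WeakDual.characterSpace ℂ 𝔄} (hB : actB.IsLeftTrivial f) (actC : CompatibleAction 𝔄 C)
    (α : 𝔄) (c : C) : star (f (star α)) • c - actC.left α c ∈ balancedFiber actB actC := by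
  intro b
  have h := generator_mem_balancedIdeal actB actC α b c
  rwa [hB.right_eq, TensorProduct.smul_tmul, ← TensorProduct.tmul_sub] at h

/-- For `b = b₁ b₂` one has `b ⊗ c' c = (b₁ ⊗ c') (b₂ ⊗ c)`, and products span `B` by
`mem_span_mul`. -/
theorem mul_mem_balancedFiber [PartialOrder B] [StarOrderedRing B] {actB : CompatibleAction 𝔄 B}
    {actC : CompatibleAction 𝔄 C} {c : C} (hc : c ∈ balancedFiber actB actC) (c' : C) :
    c' * c ∈ balancedFiber actB actC ∧ c * c' ∈ balancedFiber actB actC := by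
  refine ⟨fun b => ?_, fun b => ?_⟩ <;>
  · induction mem_span_mul b using Submodule.span_induction with
    | mem x hx =>
      obtain ⟨⟨b₁, b₂⟩, rfl⟩ := hx
      dsimp only
      rw [← Algebra.TensorProduct.tmul_mul_tmul]
      first
        | exact (mul_mem_balancedIdeal (hc b₂) _).1
        | exact (mul_mem_balancedIdeal (hc b₁) _).2
    | zero => simp
    | add x y _ _ hx hy =>
      rw [TensorProduct.add_tmul]
      exact add_mem hx hy
    | smul r x _ hx =>
      rw [← TensorProduct.smul_tmul']
      exact Submodule.smul_mem _ r hx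

/-- For left-trivial actions with the same character, `u ⊗ id` maps `I_{A,C}` into `I_{B,C}`. -/
theorem balancedIdeal_le_comap [PartialOrder B] [StarOrderedRing B] {actA : CompatibleAction 𝔄 A}
    {actB : CompatibleAction 𝔄 B} {f : WeakDual.characterSpace ℂ 𝔄} (hA : actA.IsLeftTrivial f)
    (hB : actB.IsLeftTrivial f) (actC : CompatibleAction 𝔄 C) (u : A →ₗ[ℂ] B) :
    balancedIdeal actA actC ≤
      (balancedIdeal actB actC).comap (TensorProduct.map u LinearMap.id) := by
  set S : Submodule ℂ (A ⊗[ℂ] C) :=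
    Submodule.span ℂ {x | ∃ a : A, ∃ c ∈ balancedFiber actB actC, a ⊗ₜ[ℂ] c = x} with hS
  have hmem : ∀ (a : A) {c : C}, c ∈ balancedFiber actB actC → a ⊗ₜ[ℂ] c ∈ S :=
    fun a c hc => Submodule.subset_span ⟨a, c, hc, rfl⟩
  -- `S` is `A ⊙ J` with `J` the balanced fiber, and is one of the ideals in the infimum defining
  -- `I_{A,C}`.
  have h1 : balancedIdeal actA actC ≤ S := by
    refine sInf_le ⟨fun α a c => ?_, fun t s hs => ?_⟩
    · rw [hA.right_eq, TensorProduct.smul_tmul, ← TensorProduct.tmul_sub]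
      exact hmem a (smul_sub_left_mem_balancedFiber hB actC α c)
    · induction hs using Submodule.span_induction with
      | mem x hx =>
        obtain ⟨a, c, hc, rfl⟩ := hx
        induction t with
        | zero => simp
        | tmul a' c' =>
          rw [Algebra.TensorProduct.tmul_mul_tmul, Algebra.TensorProduct.tmul_mul_tmul]
          exact ⟨hmem _ (mul_mem_balancedFiber hc c').1, hmem _ (mul_mem_balancedFiber hc c').2⟩
        | add t t' ht ht' =>
          rw [add_mul, mul_add]
          exact ⟨add_mem ht.1 ht'.1, add_mem ht.2 ht'.2⟩
      | zero => simp
      | add x y _ _ hx hy =>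
        rw [add_mul, mul_add]
        exact ⟨add_mem hx.1 hy.1, add_mem hx.2 hy.2⟩
      | smul r x _ hx =>
        rw [mul_smul_comm, smul_mul_assoc]
        exact ⟨S.smul_mem r hx.1, S.smul_mem r hx.2⟩
  refine h1.trans (Submodule.span_le.mpr ?_)
  rintro _ ⟨a, c, hc, rfl⟩
  exact hc (u a)

/-- Every representative `y` of a class maps to a representative of the image class, so the bound on
`y` passes to the infimum. -/
theorem isModuleTensorizing_of_forall_norm_le [PartialOrder B] [StarOrderedRing B]
    {actA : CompatibleAction 𝔄 A} {actB : CompatibleAction 𝔄 B}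
    {f : WeakDual.characterSpace ℂ 𝔄} (hA : actA.IsLeftTrivial f) (hB : actB.IsLeftTrivial f)
    {u : A →ₗ[ℂ] B} {γ η : TensorNormKind}
    (h : ∀ (C : Type w) [NonUnitalCStarAlgebra C] (x : A ⊗[ℂ] C),
      cstarTensorNorm η (TensorProduct.map u LinearMap.id x : B ⊗[ℂ] C) ≤ cstarTensorNorm γ x) :
    IsModuleTensorizing.{u, v, w} γ η actA actB u := by
  intro C _ actC
  refine ⟨Submodule.mapQ _ _ _ (balancedIdeal_le_comap hA hB actC u), fun x => rfl, fun x => ?_⟩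
  refine le_iInf₂ fun y hy => ?_
  subst hy
  refine le_trans ?_ (h C y)
  unfold moduleTensorNorm
  exact iInf₂_le_of_le (TensorProduct.map u LinearMap.id y) rfl le_rfl

end Ideal

theorem mainTheorem8 {𝔄 : Type*} {A : Type u} {B : Type v}
    [NonUnitalCStarAlgebra 𝔄]
    [NonUnitalCStarAlgebra A] [PartialOrder A] [StarOrderedRing A]
    [NonUnitalCStarAlgebra B] [PartialOrder B] [StarOrderedRing B]
    (actA : CompatibleAction 𝔄 A) (actB : CompatibleAction 𝔄 B)
    (f : WeakDual.characterSpace ℂ 𝔄)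
    (hA : actA.IsLeftTrivial f) (hB : actB.IsLeftTrivial f)
    (u : A →ₗ[ℂ] B) (hu : IsModuleLinear actA actB u) :
    ((∃ φ : CompletelyPositiveMap A B, φ.toLinearMap = u) → (∀ a : A, ‖u a‖ ≤ ‖a‖) →
      IsModuleTensorizing.{u, v, w} .max .max actA actB u) ∧
    (cbNorm u ≤ 1 → IsModuleTensorizing.{u, v, w} .min .min actA actB u) := by
  refine ⟨?_, fun hcb => isModuleTensorizing_of_forall_norm_le hA hB fun C _ x =>
    minTensorNorm_map_le hcb x⟩
  rintro ⟨φ, rfl⟩ hφ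
  refine isModuleTensorizing_of_forall_norm_le hA hB fun C _ x => ?_
  -- `C` comes without an order; the spectral order makes positivity of Gram matrices over `C`
  -- available.
  let : PartialOrder C := CStarAlgebra.spectralOrder C
  have : StarOrderedRing C := CStarAlgebra.spectralOrderedRing C
  exact maxTensorNorm_map_le φ hφ x
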